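/- An independent set (IS) query to a simple undirected graph $G=([n],E)$ takes a set $U\subseteq[n]$ and answers whether $U$ is independent in $G$, that is, whether no edge of $G$ has both endpoints in $U$. **Theorem.** For every constant $c>0$ there is a constant $C>0$, depending only on $c$, such that the following holds. For every $n\ge 1$ and every $\varepsilon>0$ there is a randomized adaptive algorithm (depending only on $n$, $\varepsilon$ and $c$) that accesses an unknown simple graph $G=([n],E)$ only through IS queries and outputs a real number $\widetilde m$, such that for every such $G$, with $m=|E|$, with probability at least $1-1/n^{c}$ both $$(1-\varepsilon)\,m\le \widetilde m\le (1+\varepsilon)\,m$$ holds and the number of IS queries performed is at most $$C\left(\varepsilon^{-4}\log^5 n+\min\!\left(\sqrt m,\frac{n^2}{m}\right)\varepsilon^{-2}\log^2 n\right),$$ where $\log$ is the logarithm in base two and the minimum is $0$ if $m=0$. -/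

import Mathlib

namespace ISQuery

/-- A deterministic adaptive algorithm (decision tree) accessing an unknown graph on the vertex
set `Fin n` only through independent set queries: it either halts with a real estimate, or queries
a set `S` of vertices and continues according to the answer. -/
inductive DecisionTree (n : ℕ) : Type
  | output (estimate : ℝ) : DecisionTree n
  | query (S : Finset (Fin n)) (ifIndep ifNotIndep : DecisionTree n) : DecisionTree n

namespace DecisionTree

open Classical in
/-- The estimate returned on the input graph `G`. -/
noncomputable def estimate {n : ℕ} (G : SimpleGraph (Fin n)) : DecisionTree n → ℝ
  | output x => x
  | query S ifIndep ifNotIndep =>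
      if G.IsIndepSet (S : Set (Fin n)) then ifIndep.estimate G else ifNotIndep.estimate G

open Classical in
/-- The number of independent set queries performed on the input graph `G`. -/
noncomputable def queryCount {n : ℕ} (G : SimpleGraph (Fin n)) : DecisionTree n → ℕ
  | output _ => 0
  | query S ifIndep ifNotIndep =>
      (if G.IsIndepSet (S : Set (Fin n)) then ifIndep.queryCount G
        else ifNotIndep.queryCount G) + 1

end DecisionTree

/-- A randomized adaptive algorithm: a probability distribution on decision trees
(all internal randomness is drawn in advance, independently of the input graph). -/
abbrev RandomizedAlgorithm (n : ℕ) : Type := PMF (DecisionTree n)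

/-- The number of edges of a graph on `Fin n`. -/
noncomputable def numEdges {n : ℕ} (G : SimpleGraph (Fin n)) : ℕ := G.edgeSet.ncard

/-- `x` is a `(1 ± ε)`-approximation of `m`. -/
def IsApprox (ε m x : ℝ) : Prop := (1 - ε) * m ≤ x ∧ x ≤ (1 + ε) * m

/-- The expression inside the big-O of the query bound, with logarithms in base two. For `m = 0`
the minimum is `0`, as it is for `n ^ 2 / m` read as infinity, since the square root vanishes. -/
noncomputable def queryBound (n : ℕ) (ε m : ℝ) : ℝ :=
  (ε ^ 4)⁻¹ * Real.logb 2 n ^ 5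
    + min (Real.sqrt m) ((n : ℝ) ^ 2 / m) * (ε ^ 2)⁻¹ * Real.logb 2 n ^ 2

end ISQuery

/-! Edges can be counted exactly at a cost of O(log n) queries each. Build a maximal independent
subset P of S greedily, locating every rejected vertex by bisection. A rejected vertex v has a
neighbour in P, so rejections are paid for by edges. Sweeping P into {v} rejects exactly the
neighbours of v in P, and recursion handles the edges among rejected vertices (`sweep_spec`,
`countDarts_spec`). With W of order ε⁻², a budget of order ε⁻⁴ log n settles every graph with m ≤
W².

For larger m there are two estimators at each scale 2^j. Testing 2^j W random pairs finds enough
edges once 2^j is about n²/m. Colouring the vertices with 2^j colours and counting the monochromatic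
edges exactly is cheap once 2^j is about √m. Both counts are sums of almost pairwise independent
events, so Chebyshev bounds each failure by 1/32 (`pairTrial_bad_le`, `colorTrial_bad_le`).

A majority among O(log n) trials makes the failure of a round polynomially small
(`card_majority_bad_le`). Since m is unknown, j is increased until some round reaches a consensus.
Outside the failure event this happens while 2^j ≤ 4 min(√m, n²/m), and the costs form a geometric
series (`search_spec`, `edgeEstimator_bad_le`). -/

namespace ISQuery

/-! ### Adaptive procedures: composition, truncation, doubling search -/

/-- A deterministic adaptive procedure making independent set queries, with results in `α`. -/
inductive QueryTree (n : ℕ) (α : Type) : Type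
  | pure (a : α) : QueryTree n α
  | ask (S : Finset (Fin n)) (ifIndep ifNotIndep : QueryTree n α) : QueryTree n α

namespace QueryTree

variable {n : ℕ} {α β : Type}

/-- Sequential composition of procedures. -/
def bind : QueryTree n α → (α → QueryTree n β) → QueryTree n β
  | pure a, f => f a
  | ask S x y, f => ask S (x.bind f) (y.bind f)

open Classical in
/-- The result on the input graph `G`. -/
noncomputable def eval (G : SimpleGraph (Fin n)) : QueryTree n α → α
  | pure a => a
  | ask S x y => if G.IsIndepSet (S : Set (Fin n)) then x.eval G else y.eval G

open Classical in
/-- The number of queries performed on the input graph `G`. -/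
noncomputable def cost (G : SimpleGraph (Fin n)) : QueryTree n α → ℕ
  | pure _ => 0
  | ask S x y => (if G.IsIndepSet (S : Set (Fin n)) then x.cost G else y.cost G) + 1

/-- A real-valued procedure as a decision tree. -/
def toDecisionTree : QueryTree n ℝ → DecisionTree n
  | pure a => .output a
  | ask S x y => .query S x.toDecisionTree y.toDecisionTree

variable (G : SimpleGraph (Fin n))

@[simp] lemma eval_pure (a : α) : (pure a : QueryTree n α).eval G = a := rfl

@[simp] lemma cost_pure (a : α) : (pure a : QueryTree n α).cost G = 0 := rfl

@[simp] lemma estimate_toDecisionTree (x : QueryTree n ℝ) :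
    x.toDecisionTree.estimate G = x.eval G := by
  induction x with
  | pure a => rfl
  | ask S x y hx hy => simp only [toDecisionTree, DecisionTree.estimate, eval, hx, hy]

@[simp] lemma queryCount_toDecisionTree (x : QueryTree n ℝ) :
    x.toDecisionTree.queryCount G = x.cost G := by
  induction x with
  | pure a => rfl
  | ask S x y hx hy => simp only [toDecisionTree, DecisionTree.queryCount, cost, hx, hy]

@[simp] lemma eval_bind (x : QueryTree n α) (f : α → QueryTree n β) :
    (x.bind f).eval G = (f (x.eval G)).eval G := by
  induction x with
  | pure a => rfl
  | ask S x y hx hy => simp only [bind, eval, hx, hy]; split_ifs <;> rfl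

@[simp] lemma cost_bind (x : QueryTree n α) (f : α → QueryTree n β) :
    (x.bind f).cost G = x.cost G + (f (x.eval G)).cost G := by
  induction x with
  | pure a => simp [bind, cost, eval]
  | ask S x y hx hy => simp only [bind, eval, cost, hx, hy]; split_ifs <;> omega

/-- Run a procedure, giving up when it needs more than `b` queries. -/
def limit : ℕ → QueryTree n α → QueryTree n (Option α)
  | _, pure a => pure (some a)
  | 0, ask _ _ _ => pure none
  | b + 1, ask S x y => ask S (x.limit b) (y.limit b)

lemma cost_limit_le (b : ℕ) (x : QueryTree n α) : (x.limit b).cost G ≤ b := by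
  induction x generalizing b with
  | pure a => simp [limit]
  | ask S x y hx hy =>
    cases b with
    | zero => simp [limit]
    | succ b =>
      have := hx b
      have := hy b
      simp only [limit, cost]
      split_ifs <;> omega

lemma eval_limit (b : ℕ) (x : QueryTree n α) :
    (x.limit b).eval G = if x.cost G ≤ b then some (x.eval G) else none := by
  induction x generalizing b with
  | pure a => simp [limit]
  | ask S x y hx hy =>
    cases b with
    | zero => simp [limit, cost]
    | succ b =>
      simp only [limit, eval, cost, hx, hy]
      split_ifs <;> first | rfl | omega

/-- Run a finite family of procedures one after the other. -/
def runAll : {t : ℕ} → (Fin t → QueryTree n α) → QueryTree n (Fin t → α)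
  | 0, _ => pure Fin.elim0
  | _ + 1, x => (x 0).bind fun a => (runAll fun i => x i.succ).bind fun r => pure (Fin.cons a r)

@[simp] lemma eval_runAll {t : ℕ} (x : Fin t → QueryTree n α) :
    (runAll x).eval G = fun i => (x i).eval G := by
  induction t with
  | zero => exact funext fun i => i.elim0
  | succ t ih =>
    simp only [runAll, eval_bind, eval_pure, ih]
    funext i
    refine Fin.cases ?_ (fun i => ?_) i <;> simp

@[simp] lemma cost_runAll {t : ℕ} (x : Fin t → QueryTree n α) :
    (runAll x).cost G = ∑ i, (x i).cost G := by
  induction t with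
  | zero => simp [runAll]
  | succ t ih => simp [runAll, ih, Fin.sum_univ_succ]

/-- Run the procedures in turn until one of them succeeds; the result is `0` if none does. -/
def search : {J : ℕ} → (Fin J → QueryTree n (Option ℝ)) → QueryTree n ℝ
  | 0, _ => pure 0
  | _ + 1, r => (r 0).bind fun a => a.elim (search fun i => r i.succ) pure

/-- The costs up to round `k` sum to at most `B * (2 ^ (k + 1) - 1)`; the summand `B` on the left
avoids the subtraction. Dropping the first round doubles `B` in the induction. Rounds after `k` are
never reached, so nothing is asked of their accuracy. -/
lemma search_spec {J : ℕ} (r : Fin J → QueryTree n (Option ℝ)) (p : ℝ → Prop) (k : Fin J)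
    (B : ℕ) (hcost : ∀ i, (r i).cost G ≤ B * 2 ^ (i : ℕ))
    (hp : ∀ i ≤ k, ∀ x, (r i).eval G = some x → p x) (hk : (r k).eval G ≠ none) :
    p ((search r).eval G) ∧ (search r).cost G + B ≤ B * 2 ^ ((k : ℕ) + 1) := by
  induction J generalizing B with
  | zero => exact k.elim0
  | succ J ih =>
    have h0 := hcost 0
    simp only [Fin.val_zero, pow_zero, mul_one] at h0
    simp only [search, eval_bind, cost_bind]
    cases he : (r 0).eval G with
    | some x =>
      refine ⟨hp 0 (Fin.zero_le k) x he, ?_⟩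
      simp only [Option.elim, cost_pure]
      have : B * 1 ≤ B * 2 ^ (k : ℕ) := Nat.mul_le_mul_left _ Nat.one_le_two_pow
      rw [pow_succ]
      nlinarith
    | none =>
      have hk0 : k ≠ 0 := by rintro rfl; exact hk he
      obtain ⟨k, rfl⟩ := Fin.exists_succ_eq.2 hk0
      have := ih (fun i => r i.succ) k (B * 2)
        (fun i => (hcost i.succ).trans_eq (by rw [Fin.val_succ, pow_succ]; ring))
        (fun i hi => hp i.succ (Fin.succ_le_succ_iff.2 hi)) hk
      refine ⟨this.1, ?_⟩
      have h2 := this.2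
      simp only [Option.elim, Fin.val_succ]
      rw [pow_succ 2 ((k : ℕ) + 1)]
      nlinarith

end QueryTree

end ISQuery

/-! ### Greedy independent sets by bisection -/

namespace ISQuery

open QueryTree

variable {n : ℕ}

/-- Split the vertices of `l` greedily into those which keep `P` independent and the others, by
divide and conquer; `d` bounds the depth of the recursion. -/
def sweep : ℕ → Finset (Fin n) → List (Fin n) → QueryTree n (Finset (Fin n) × Finset (Fin n))
  | 0, P, l => ask (P ∪ l.toFinset) (pure (P ∪ l.toFinset, ∅)) (pure (P, l.toFinset))
  | d + 1, P, l => ask (P ∪ l.toFinset) (pure (P ∪ l.toFinset, ∅))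
      ((sweep d P (l.take (2 ^ d))).bind fun a => (sweep d a.1 (l.drop (2 ^ d))).bind fun b =>
        pure (b.1, a.2 ∪ b.2))

/-- `a` is an outcome of sweeping `l` into the independent set `P`. -/
structure IsSweep (G : SimpleGraph (Fin n)) (P : Finset (Fin n)) (l : List (Fin n))
    (a : Finset (Fin n) × Finset (Fin n)) : Prop where
  indep : G.IsIndepSet (a.1 : Set (Fin n))
  subset : P ⊆ a.1
  union : a.1 ∪ a.2 = P ∪ l.toFinset
  rejected_subset : a.2 ⊆ l.toFinset
  exists_adj : ∀ v ∈ a.2, ∃ u ∈ a.1, G.Adj v u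

variable (G : SimpleGraph (Fin n))

/-- A negative answer guarantees a rejection among the vertices of that call, which pays for the two
recursive queries. Each rejected vertex is charged at most once per level, hence two queries for
each of the `d` levels. -/
lemma sweep_spec (d : ℕ) (P : Finset (Fin n)) (l : List (Fin n)) (hl : l.length ≤ 2 ^ d)
    (hn : l.Nodup) (hP : G.IsIndepSet (P : Set (Fin n))) :
    IsSweep G P l ((sweep d P l).eval G) ∧
      (sweep d P l).cost G ≤ 1 + 2 * d * ((sweep d P l).eval G).2.card := by
  induction d generalizing P l with
  | zero =>
    simp only [sweep, eval, cost]
    split_ifs with h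
    · exact ⟨⟨h, Finset.subset_union_left, by simp, by simp, by simp⟩, by simp⟩
    · refine ⟨⟨hP, subset_rfl, rfl, subset_rfl, ?_⟩, by simp⟩
      intro v hv
      by_contra! hcon
      refine h ?_
      have hv' : v ∈ l := by simpa using hv
      have hl1 : l = [v] := by
        match l, hl, hv' with
        | [a], _, hv' => simp at hv'; rw [hv']
        | a :: b :: l, hl, _ => simp at hl
      subst hl1
      intro a ha b hb hab
      simp only [List.toFinset_cons, List.toFinset_nil, insert_empty_eq, Finset.coe_union,
        Finset.coe_singleton, Set.mem_union, Finset.mem_coe, Set.mem_singleton_iff] at ha hb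
      rcases ha with ha | rfl <;> rcases hb with hb | rfl
      · exact hP ha hb hab
      · exact fun h => hcon a ha h.symm
      · exact hcon b hb
      · exact absurd rfl hab
  | succ d ih =>
    simp only [sweep, eval, cost]
    split_ifs with h
    · exact ⟨⟨h, Finset.subset_union_left, by simp, by simp, by simp⟩, by simp⟩
    · obtain ⟨h1, c1⟩ := ih P (l.take (2 ^ d)) (by simp) (hn.sublist (List.take_sublist _ _)) hP
      set a := (sweep d P (l.take (2 ^ d))).eval G with ha
      obtain ⟨h2, c2⟩ := ih a.1 (l.drop (2 ^ d)) (by rw [List.length_drop]; omega)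
        (hn.sublist (List.drop_sublist _ _)) h1.indep
      simp only [eval_bind, cost_bind, ← ha, eval_pure, cost_pure]
      set b := (sweep d a.1 (l.drop (2 ^ d))).eval G with hb
      have htd : (l.take (2 ^ d)).toFinset ∪ (l.drop (2 ^ d)).toFinset = l.toFinset := by
        rw [← List.toFinset_append, List.take_append_drop]
      have hU : b.1 ∪ (a.2 ∪ b.2) = P ∪ l.toFinset := by
        rw [← htd, ← Finset.union_assoc P, ← h1.union, Finset.union_right_comm, ← h2.union]
        ext; simp; tauto
      have hdisj : Disjoint a.2 b.2 := by
        rw [Finset.disjoint_left]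
        intro x hx hy
        have hx' := h1.rejected_subset hx
        have hy' := h2.rejected_subset hy
        rw [List.mem_toFinset] at hx' hy'
        exact List.disjoint_take_drop hn le_rfl hx' hy'
      refine ⟨⟨h2.indep, h1.subset.trans h2.subset, hU, ?_, ?_⟩, ?_⟩
      · rw [← htd]
        exact Finset.union_subset_union h1.rejected_subset h2.rejected_subset
      · intro v hv
        rcases Finset.mem_union.1 hv with hv | hv
        · obtain ⟨u, hu, hvu⟩ := h1.exists_adj v hv
          exact ⟨u, h2.subset hu, hvu⟩
        · exact h2.exists_adj v hv
      · rw [Finset.card_union_of_disjoint hdisj]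
        -- Without rejections the final independent set would be the queried union, contrary to the
        -- answer.
        have hpos : 0 < a.2.card + b.2.card := by
          by_contra h0
          have ha0 : a.2 = ∅ := Finset.card_eq_zero.1 (by omega)
          have hb0 : b.2 = ∅ := Finset.card_eq_zero.1 (by omega)
          rw [ha0, hb0, Finset.union_empty, Finset.union_empty] at hU
          exact h (hU ▸ h2.indep)
        nlinarith

/-! ### Exact edge counting -/

open Classical in
/-- The number of ordered pairs of adjacent vertices in `A × B`. -/
noncomputable def adjCount (A B : Finset (Fin n)) : ℕ :=
  ∑ u ∈ A, ∑ v ∈ B, if G.Adj u v then 1 else 0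

lemma adjCount_comm (A B : Finset (Fin n)) : adjCount G A B = adjCount G B A := by
  unfold adjCount
  rw [Finset.sum_comm]
  exact Finset.sum_congr rfl fun v _ => Finset.sum_congr rfl fun u _ =>
    by rw [G.adj_comm v u]

lemma adjCount_eq_zero {P : Finset (Fin n)} (h : G.IsIndepSet (P : Set (Fin n))) :
    adjCount G P P = 0 := by
  refine Finset.sum_eq_zero fun u hu => Finset.sum_eq_zero fun v hv => if_neg fun huv => ?_
  exact h hu hv huv.ne huv

lemma adjCount_union {P R : Finset (Fin n)} (hd : Disjoint P R)
    (h : G.IsIndepSet (P : Set (Fin n))) :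
    adjCount G (P ∪ R) (P ∪ R) = adjCount G R R + 2 * adjCount G R P := by
  have h1 := adjCount_eq_zero G h
  have h2 := adjCount_comm G P R
  unfold adjCount at *
  simp only [Finset.sum_union hd, Finset.sum_add_distrib]
  omega

/-- Since `P` is independent, the only possible conflicts in this sweep are with `v`, so the order
of insertion is irrelevant and exactly the neighbours of `v` are rejected. -/
lemma card_rejected {P : Finset (Fin n)} {v : Fin n} (hP : G.IsIndepSet (P : Set (Fin n)))
    {a : Finset (Fin n) × Finset (Fin n)} (ha : IsSweep G {v} P.toList a) :
    a.2.card = adjCount G {v} P := by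
  classical
  have : a.2 = P.filter (G.Adj v) := by
    ext w
    rw [Finset.mem_filter]
    constructor
    · intro hw
      have hwP : w ∈ P := by simpa using ha.rejected_subset hw
      refine ⟨hwP, ?_⟩
      obtain ⟨u, hu, hwu⟩ := ha.exists_adj w hw
      have : u ∈ {v} ∪ P.toList.toFinset := ha.union ▸ Finset.mem_union_left _ hu
      simp only [Finset.toList_toFinset, Finset.mem_union, Finset.mem_singleton] at this
      rcases this with rfl | huP
      · exact hwu.symm
      · exact absurd hwu (hP hwP huP hwu.ne)
    · rintro ⟨hw, hvw⟩
      have hv : v ∈ a.1 := ha.subset (Finset.mem_singleton_self v)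
      have : w ∈ a.1 ∪ a.2 := by rw [ha.union]; simp [hw]
      rcases Finset.mem_union.1 this with h | h
      · exact absurd hvw (ha.indep hv h hvw.ne)
      · exact h
  rw [this, adjCount, Finset.sum_singleton, Finset.card_filter]

/-- Count the ordered pairs of adjacent vertices in `S`; the first argument bounds the depth of
the sweeps, the second one the depth of the recursion. -/
noncomputable def countDarts (d : ℕ) : ℕ → Finset (Fin n) → QueryTree n ℕ
  | 0, _ => pure 0
  | f + 1, S => if S = ∅ then pure 0 else
      (sweep d ∅ S.toList).bind fun a =>
        (runAll fun v => if v ∈ a.2 then sweep d {v} a.1.toList else pure (∅, ∅)).bind fun r =>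
          (countDarts d f a.2).bind fun m => pure (m + 2 * ∑ v, (r v).2.card)

lemma cost_countDarts_empty (d f : ℕ) : (countDarts d f (∅ : Finset (Fin n))).cost G = 0 := by
  cases f <;> simp [countDarts]

/-- With accepted set P and rejected set R, the pairs in S are those in R plus twice those between R
and P. Every vertex of R has a neighbour in P, so |R| is at most the number of R-P pairs, and these
pairs pay for all sweeps. -/
lemma countDarts_spec {d : ℕ} (hd : n ≤ 2 ^ d) (f : ℕ) (S : Finset (Fin n))
    (hf : adjCount G S S ≤ f) :
    (countDarts d f S).eval G = adjCount G S S ∧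
      (countDarts d f S).cost G ≤ 1 + (4 * d + 2) * adjCount G S S := by
  induction f generalizing S with
  | zero => exact ⟨by simp [countDarts, Nat.le_zero.1 hf], by simp [countDarts]⟩
  | succ f ih =>
    rw [countDarts]
    split_ifs with hS
    · subst hS
      simp [adjCount]
    have hlen : ∀ T : Finset (Fin n), T.toList.length ≤ 2 ^ d := fun T => by
      rw [Finset.length_toList]
      exact (T.card_le_univ.trans_eq (Fintype.card_fin n)).trans hd
    obtain ⟨h1, c1⟩ := sweep_spec G d ∅ S.toList (hlen S) S.nodup_toList (by simp)
    simp only [eval_bind, cost_bind, eval_pure, cost_pure, eval_runAll, cost_runAll]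
    set a := (sweep d ∅ S.toList).eval G with ha
    have h2 : ∀ v : Fin n, v ∈ a.2 → _ := fun v _ =>
      sweep_spec G d {v} a.1.toList (hlen _) (Finset.nodup_toList _) (by simp)
    have hdisj : Disjoint a.1 a.2 := by
      rw [Finset.disjoint_left]
      intro v hv hv2
      obtain ⟨u, hu, hvu⟩ := h1.exists_adj v hv2
      exact h1.indep hv hu hvu.ne hvu
    have hU : a.1 ∪ a.2 = S := by rw [h1.union]; simp
    have hD := adjCount_union G hdisj h1.indep
    rw [hU] at hD
    have hval : ∑ v, ((if v ∈ a.2 then sweep d {v} a.1.toList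
        else pure (∅, ∅)).eval G).2.card = adjCount G a.2 a.1 := by
      rw [adjCount, ← Finset.sum_filter_add_sum_filter_not Finset.univ (· ∈ a.2)]
      simp only [Finset.filter_univ_mem]
      rw [Finset.sum_eq_zero (s := Finset.univ.filter (· ∉ a.2)), add_zero]
      · refine Finset.sum_congr rfl fun v hv => ?_
        rw [if_pos hv, card_rejected G h1.indep (h2 v hv).1, adjCount, Finset.sum_singleton]
      · intro v hv
        rw [if_neg (Finset.mem_filter.1 hv).2]
        simp
    have hcost : ∑ v, (if v ∈ a.2 then sweep d {v} a.1.toList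
        else pure (∅, ∅)).cost G ≤ a.2.card + 2 * d * adjCount G a.2 a.1 := by
      rw [← Finset.sum_filter_add_sum_filter_not Finset.univ (· ∈ a.2)]
      simp only [Finset.filter_univ_mem]
      rw [Finset.sum_eq_zero (s := Finset.univ.filter (· ∉ a.2)), add_zero]
      · rw [adjCount, Finset.mul_sum, Finset.card_eq_sum_ones, ← Finset.sum_add_distrib]
        refine Finset.sum_le_sum fun v hv => ?_
        rw [if_pos hv]
        refine (h2 v hv).2.trans_eq ?_
        rw [card_rejected G h1.indep (h2 v hv).1, adjCount, Finset.sum_singleton]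
      · intro v hv
        rw [if_neg (Finset.mem_filter.1 hv).2]
        simp
    have hR : a.2.card ≤ adjCount G a.2 a.1 := by
      rw [adjCount, Finset.card_eq_sum_ones]
      refine Finset.sum_le_sum fun v hv => ?_
      obtain ⟨u, hu, hvu⟩ := h1.exists_adj v hv
      refine le_trans ?_ (Finset.single_le_sum (fun _ _ => Nat.zero_le _) hu)
      simp [hvu]
    -- The additive 1 of the recursive bound must be paid for by a rejected vertex. If there is
    -- none, the recursive call is on `∅` and free.
    rcases a.2.eq_empty_or_nonempty with h0 | h0
    · have hz : adjCount G a.2 a.1 = 0 := by simp [h0, adjCount]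
      have hz' : adjCount G a.2 a.2 = 0 := by simp [h0, adjCount]
      have hv := (ih a.2 (by omega)).1
      rw [hval, hv, hD]
      refine ⟨rfl, ?_⟩
      rw [h0, Finset.card_empty] at c1
      rw [hz, h0, Finset.card_empty] at hcost
      rw [h0, cost_countDarts_empty]
      omega
    · have hpos : 0 < a.2.card := h0.card_pos
      -- A rejected vertex removes at least two ordered pairs, so one less unit of recursion depth
      -- suffices.
      obtain ⟨hv, hc⟩ := ih a.2 (by omega)
      rw [hval, hv, hD]
      refine ⟨rfl, ?_⟩
      have : 2 * d * a.2.card ≤ 2 * d * adjCount G a.2 a.1 := Nat.mul_le_mul_left _ hR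
      nlinarith

lemma adjCount_univ : adjCount G Finset.univ Finset.univ = 2 * numEdges G := by
  classical
  have h := G.sum_degrees_eq_twice_card_edges
  rw [numEdges, ← SimpleGraph.coe_edgeFinset, Set.ncard_coe_finset, ← h, adjCount]
  refine Finset.sum_congr rfl fun v _ => ?_
  rw [← SimpleGraph.card_neighborFinset_eq_degree, SimpleGraph.neighborFinset_eq_filter,
    Finset.card_filter]

end ISQuery

/-! ### Probability by counting: independence, Chebyshev, amplification, union bound -/

namespace ISQuery

open Finset Function

open Classical in
-- Independence of one coordinate from the others: exchanging `f w` with a fresh value `x` is a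
-- bijection, because neither `Q` nor `D` depends on coordinate `w`.
lemma card_coordinate_mem {ι : Type} [Fintype ι] [DecidableEq ι] {α : ι → Type} [∀ i, Fintype (α i)]
    (w : ι) (Q : (∀ i, α i) → Prop) (D : (∀ i, α i) → Finset (α w)) (d : ℕ)
    (hQ : ∀ f x, Q (update f w x) ↔ Q f) (hD : ∀ f x, D (update f w x) = D f)
    (hd : ∀ f, (D f).card = d) :
    (univ.filter fun f => Q f ∧ f w ∈ D f).card * Fintype.card (α w)
      = d * (univ.filter Q).card := by
  have h1 : ((univ.filter Q).sigma D).card = d * (univ.filter Q).card := by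
    rw [card_sigma, sum_congr rfl fun f _ => hd f, sum_const, smul_eq_mul, mul_comm]
  rw [← h1, ← Finset.card_univ, ← card_product]
  refine card_nbij' (fun q => ⟨update q.1 w q.2, q.1 w⟩) (fun q => (update q.1 w q.2, q.1 w))
    ?_ ?_ ?_ ?_
  · rintro ⟨f, x⟩ h
    simpa [hQ, hD] using h
  · rintro ⟨f, x⟩ h
    simpa [hQ, hD] using h
  · rintro ⟨f, x⟩ -
    simp
  · rintro ⟨f, x⟩ -
    simp

open Classical in
/-- Chebyshev's inequality for the number of occurring events of a family in which every event is
uncorrelated with all but two others. -/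
lemma card_deviation_mul_sq_le {Ω I : Type} [Fintype Ω] [Fintype I] (Z : I → Ω → Prop) (p : ℝ)
    (hp : 0 ≤ p) (h1 : ∀ i, ((univ.filter (Z i)).card : ℝ) = p * Fintype.card Ω)
    (h2 : ∀ i, ∃ E : Finset I, E.card ≤ 2 ∧ ∀ i' ∉ E,
      ((univ.filter fun ω => Z i ω ∧ Z i' ω).card : ℝ) = p ^ 2 * Fintype.card Ω)
    (a : ℝ) (ha : 0 ≤ a) :
    ((univ.filter fun ω => a ≤ |((univ.filter fun i => Z i ω).card : ℝ)
        - Fintype.card I * p|).card : ℝ) * a ^ 2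
      ≤ 2 * (Fintype.card I * p) * Fintype.card Ω := by
  set N : ℝ := (Fintype.card Ω : ℝ) with hN
  have hN0 : 0 ≤ N := Nat.cast_nonneg _
  set μ : ℝ := Fintype.card I * p with hμ
  set Y : Ω → ℝ := fun ω => ((univ.filter fun i => Z i ω).card : ℝ) with hY
  have hYs : ∀ ω, Y ω = ∑ i, if Z i ω then (1 : ℝ) else 0 := fun ω => by simp [hY]
  have e1 : ∑ ω, Y ω = μ * N := by
    simp only [hYs]
    rw [sum_comm]
    have : ∀ i, ∑ ω, (if Z i ω then (1 : ℝ) else 0) = p * N := fun i => by rw [← h1 i]; simp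
    simp only [this, sum_const, Finset.card_univ, nsmul_eq_mul, hμ]
    ring
  -- For fixed `i`, each of the at most two exceptional partners contributes at most `p`, and every
  -- other one contributes `p ^ 2`.
  have e2 : ∑ ω, Y ω ^ 2 ≤ (2 * μ + μ ^ 2) * N := by
    have : ∀ ω, Y ω ^ 2 = ∑ i, ∑ i', if Z i ω ∧ Z i' ω then (1 : ℝ) else 0 := fun ω => by
      rw [hYs, sq, sum_mul_sum]
      refine sum_congr rfl fun i _ => sum_congr rfl fun i' _ => ?_
      by_cases hi : Z i ω <;> by_cases hi' : Z i' ω <;> simp [hi, hi']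
    simp only [this]
    rw [sum_comm]
    have key : ∀ i, ∑ ω, ∑ i', (if Z i ω ∧ Z i' ω then (1 : ℝ) else 0)
        ≤ (2 * p + Fintype.card I * p ^ 2) * N := by
      intro i
      obtain ⟨E, hE, hEi⟩ := h2 i
      rw [sum_comm]
      have hb : ∀ i', ∑ ω, (if Z i ω ∧ Z i' ω then (1 : ℝ) else 0)
          ≤ (if i' ∈ E then p * N else 0) + p ^ 2 * N := by
        intro i'
        have hs : ∑ ω, (if Z i ω ∧ Z i' ω then (1 : ℝ) else 0)
          = ((univ.filter fun ω => Z i ω ∧ Z i' ω).card : ℝ) := by simp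
        rw [hs]
        split_ifs with h
        · have : ((univ.filter fun ω => Z i ω ∧ Z i' ω).card : ℝ) ≤ p * N := by
            rw [← h1 i]
            exact_mod_cast card_le_card fun ω => by simp +contextual
          have : 0 ≤ p ^ 2 * N := by positivity
          linarith
        · rw [hEi i' h, zero_add]
      refine (sum_le_sum fun i' _ => hb i').trans ?_
      rw [sum_add_distrib, sum_ite_mem, univ_inter, sum_const, sum_const, Finset.card_univ,
        nsmul_eq_mul, nsmul_eq_mul]
      have : (E.card : ℝ) * (p * N) ≤ 2 * (p * N) :=
        mul_le_mul_of_nonneg_right (by exact_mod_cast hE) (by positivity)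
      linarith
    refine (sum_le_sum fun i _ => key i).trans ?_
    rw [sum_const, Finset.card_univ, nsmul_eq_mul, hμ]
    apply le_of_eq
    ring
  have e3 : ∑ ω, (Y ω - μ) ^ 2 ≤ 2 * μ * N := by
    have : ∀ ω, (Y ω - μ) ^ 2 = Y ω ^ 2 - 2 * μ * Y ω + μ ^ 2 := fun ω => by ring
    simp only [this, sum_add_distrib, sum_sub_distrib, ← mul_sum, e1, sum_const,
      Finset.card_univ, nsmul_eq_mul]
    rw [← hN]
    linarith
  refine le_trans ?_ e3
  rw [← nsmul_eq_mul, ← sum_const (s := univ.filter fun ω => a ≤ |Y ω - μ|) (b := a ^ 2)]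
  refine (sum_le_sum fun ω hω => ?_).trans
    (sum_le_sum_of_subset_of_nonneg (filter_subset _ _) fun ω _ _ => sq_nonneg (Y ω - μ))
  rw [← sq_abs (Y ω - μ)]
  exact pow_le_pow_left₀ ha (mem_filter.1 hω).2 2

open Classical in
/-- If an event has probability at most `1 / 16`, then it occurs in at least half of `t`
independent trials with probability at most `2⁻ᵗ`. -/
lemma card_majority_bad_le {Ω : Type} [Fintype Ω] (bad : Ω → Prop)
    (h : (univ.filter bad).card * 16 ≤ Fintype.card Ω) (t : ℕ) :
    (univ.filter fun f : Fin t → Ω => t ≤ 2 * (univ.filter fun i => bad (f i)).card).card * 2 ^ t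
      ≤ Fintype.card (Fin t → Ω) := by
  -- Exponential moment method: the mean weight is at most 2, while a tuple with at least half bad
  -- entries has weight at least `16 ^ (t / 2) = 4 ^ t`. Markov's inequality gives `2 ^ t / 4 ^ t`.
  set w : Ω → ℕ := fun x => if bad x then 16 else 1 with hw
  have hsum : ∑ x, w x ≤ 2 * Fintype.card Ω := by
    have : ∀ x, w x = 1 + if bad x then 15 else 0 := fun x => by simp only [hw]; split_ifs <;> rfl
    simp only [this, sum_add_distrib, sum_const, Finset.card_univ, smul_eq_mul, mul_one,
      ← sum_filter]
    change Fintype.card Ω + (univ.filter bad).card * 15 ≤ _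
    omega
  have hpow : ∑ f : Fin t → Ω, ∏ i, w (f i) = (∑ x, w x) ^ t := by
    rw [Fintype.sum_pow]
  have hlow : (univ.filter fun f : Fin t → Ω =>
      t ≤ 2 * (univ.filter fun i => bad (f i)).card).card * 4 ^ t
        ≤ ∑ f : Fin t → Ω, ∏ i, w (f i) := by
    rw [← smul_eq_mul, ← sum_const]
    refine (sum_le_sum fun f hf => ?_).trans
      (sum_le_sum_of_subset_of_nonneg (filter_subset _ _) fun f _ _ => Nat.zero_le _)
    have hf := (mem_filter.1 hf).2
    rw [prod_ite, prod_const, prod_const, one_pow, mul_one]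
    calc 4 ^ t ≤ 4 ^ (2 * (univ.filter fun i => bad (f i)).card) :=
          Nat.pow_le_pow_right (by norm_num) hf
      _ = _ := by rw [pow_mul]; rfl
  have : (univ.filter fun f : Fin t → Ω =>
      t ≤ 2 * (univ.filter fun i => bad (f i)).card).card * 2 ^ t * 2 ^ t
        ≤ Fintype.card (Fin t → Ω) * 2 ^ t := by
    calc _ = (univ.filter fun f : Fin t → Ω =>
          t ≤ 2 * (univ.filter fun i => bad (f i)).card).card * 4 ^ t := by
            rw [mul_assoc, ← mul_pow]; rfl
      _ ≤ (2 * Fintype.card Ω) ^ t := (hlow.trans_eq hpow).trans (Nat.pow_le_pow_left hsum t)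
      _ = _ := by rw [Fintype.card_fun, Fintype.card_fin, mul_pow, mul_comm]
  exact Nat.le_of_mul_le_mul_right this (by positivity)

open Classical in
lemma card_exists_bad_le {J : ℕ} {Ω : Fin J → Type} [∀ j, Fintype (Ω j)] [∀ j, Nonempty (Ω j)]
    (bad : ∀ j, Ω j → Prop) (K : ℕ)
    (h : ∀ j, (univ.filter (bad j)).card * K ≤ Fintype.card (Ω j)) :
    (univ.filter fun ω : ∀ j, Ω j => ∃ j, bad j (ω j)).card * K
      ≤ J * Fintype.card (∀ j, Ω j) := by
  have hsub : (univ.filter fun ω : ∀ j, Ω j => ∃ j, bad j (ω j))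
      = univ.biUnion fun j => univ.filter fun ω : ∀ j, Ω j => bad j (ω j) := by
    ext; simp
  rw [hsub]
  refine (Nat.mul_le_mul_right _ card_biUnion_le).trans ?_
  rw [sum_mul]
  refine (sum_le_card_nsmul _ _ (Fintype.card (∀ j, Ω j)) fun j _ => ?_).trans_eq (by simp)
  have := card_coordinate_mem j (fun _ : ∀ j, Ω j => True) (fun _ => univ.filter (bad j))
    (univ.filter (bad j)).card (by simp) (by simp) (by simp)
  simp only [mem_filter, mem_univ, true_and, filter_true, Finset.card_univ] at this
  refine Nat.le_of_mul_le_mul_right ?_ (Fintype.card_pos (α := Ω j))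
  calc _ = (univ.filter fun ω : ∀ j, Ω j => bad j (ω j)).card * Fintype.card (Ω j) * K := by ring
    _ = (univ.filter (bad j)).card * K * Fintype.card (∀ j, Ω j) := by rw [this]; ring
    _ ≤ Fintype.card (Ω j) * Fintype.card (∀ j, Ω j) := Nat.mul_le_mul_right _ (h j)
    _ = _ := mul_comm _ _

/-! ### Concentration for sampled pairs and monochromatic edges -/

variable {n : ℕ} (G : SimpleGraph (Fin n))

open Classical in
lemma card_fst_snd_adj :
    (univ.filter fun q : Fin n × Fin n => G.Adj q.1 q.2).card = 2 * numEdges G := by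
  rw [← adjCount_univ, adjCount, card_filter, ← univ_product_univ, sum_product]

open Classical in
/-- The number of adjacent pairs in a sample. -/
noncomputable def sampleCount {s : ℕ} (x : Fin s → Fin n × Fin n) : ℕ :=
  (univ.filter fun i => G.Adj (x i).1 (x i).2).card

open Classical in
lemma sampleCount_deviation (hn : 0 < n) (s : ℕ) (a : ℝ) (ha : 0 ≤ a) :
    ((univ.filter fun x : Fin s → Fin n × Fin n =>
        a ≤ |(sampleCount G x : ℝ) - s * (2 * numEdges G / n ^ 2)|).card : ℝ) * a ^ 2
      ≤ 2 * (s * (2 * numEdges G / n ^ 2)) * Fintype.card (Fin s → Fin n × Fin n) := by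
  have hn' : (n : ℝ) ≠ 0 := by positivity
  set D := univ.filter fun q : Fin n × Fin n => G.Adj q.1 q.2 with hD
  have hDc : D.card = 2 * numEdges G := card_fst_snd_adj G
  have hone : ∀ i : Fin s, ((univ.filter fun x : Fin s → Fin n × Fin n =>
      G.Adj (x i).1 (x i).2).card : ℝ)
        = 2 * numEdges G / n ^ 2 * Fintype.card (Fin s → Fin n × Fin n) := by
    intro i
    have := card_coordinate_mem i (fun _ : Fin s → Fin n × Fin n => True) (fun _ => D)
      D.card (by simp) (by simp) (by simp)
    simp only [hD, mem_filter, mem_univ, true_and, filter_true, Finset.card_univ,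
      Fintype.card_prod, Fintype.card_fin] at this
    rw [← hD, hDc] at this
    have : ((univ.filter fun x : Fin s → Fin n × Fin n => G.Adj (x i).1 (x i).2).card : ℝ)
        * (n * n) = 2 * numEdges G * Fintype.card (Fin s → Fin n × Fin n) := by exact_mod_cast this
    field_simp
    linarith
  have := card_deviation_mul_sq_le (fun (i : Fin s) (x : Fin s → Fin n × Fin n) =>
    G.Adj (x i).1 (x i).2) (2 * numEdges G / n ^ 2) (by positivity) hone
    (fun i => ⟨{i}, by simp, fun i' hi' => ?_⟩) a ha
  · rw [Fintype.card_fin] at this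
    unfold sampleCount
    convert this
  · have hne : i ≠ i' := fun h => hi' (by simp [h])
    have := card_coordinate_mem i' (fun x : Fin s → Fin n × Fin n => G.Adj (x i).1 (x i).2)
      (fun _ => D) D.card (fun f y => by rw [update_of_ne hne]) (by simp) (by simp)
    simp only [hD, mem_filter, mem_univ, true_and, Fintype.card_prod, Fintype.card_fin] at this
    rw [← hD, hDc] at this
    have : ((univ.filter fun x : Fin s → Fin n × Fin n =>
        G.Adj (x i).1 (x i).2 ∧ G.Adj (x i').1 (x i').2).card : ℝ)
        * (n * n) = 2 * numEdges G * (univ.filter fun x : Fin s → Fin n × Fin n =>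
          G.Adj (x i).1 (x i).2).card := by exact_mod_cast this
    rw [hone i] at this
    field_simp at this ⊢
    linarith

/-- The vertices of colour `i`. -/
def colorClass {k : ℕ} (f : Fin n → Fin k) (i : Fin k) : Finset (Fin n) :=
  univ.filter fun v => f v = i

/-- The number of ordered pairs of adjacent vertices of the same colour. -/
noncomputable def monoCount {k : ℕ} (f : Fin n → Fin k) : ℕ :=
  ∑ i, adjCount G (colorClass f i) (colorClass f i)

open Classical in
lemma monoCount_eq_card {k : ℕ} (f : Fin n → Fin k) :
    monoCount G f = (univ.filter fun q : {q : Fin n × Fin n // G.Adj q.1 q.2} =>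
      f q.1.2 = f q.1.1).card := by
  have h : (univ.filter fun q : {q : Fin n × Fin n // G.Adj q.1 q.2} =>
      f q.1.2 = f q.1.1).card
        = (univ.filter fun q : Fin n × Fin n => f q.2 = f q.1 ∧ G.Adj q.1 q.2).card := by
    rw [← card_map (Embedding.subtype _)]
    congr 1
    ext q
    simp
  rw [h, card_filter, ← univ_product_univ, sum_product]
  simp only [monoCount, adjCount, colorClass, sum_filter]
  rw [sum_comm]
  refine sum_congr rfl fun u _ => ?_
  simp only [sum_ite_eq, mem_univ, if_true, ite_and]

open Classical in
-- Each ordered edge is correlated only with itself and its reversal. Any other edge has an endpoint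
-- off the first one; revealing that endpoint last, its colour matches with conditional probability
-- `1 / k`.
lemma monoCount_deviation (k : ℕ) (hk : 0 < k) (a : ℝ) (ha : 0 ≤ a) :
    ((univ.filter fun f : Fin n → Fin k =>
        a ≤ |(monoCount G f : ℝ) - 2 * numEdges G / k|).card : ℝ) * a ^ 2
      ≤ 2 * (2 * numEdges G / k) * Fintype.card (Fin n → Fin k) := by
  have hk' : (k : ℝ) ≠ 0 := by positivity
  have hI : (Fintype.card {q : Fin n × Fin n // G.Adj q.1 q.2} : ℝ) * (k : ℝ)⁻¹
      = 2 * numEdges G / k := by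
    rw [Fintype.card_subtype, card_fst_snd_adj, div_eq_mul_inv]
    push_cast
    rfl
  have hone : ∀ (Q : (Fin n → Fin k) → Prop) (u v : Fin n), u ≠ v →
      (∀ f x, Q (update f v x) ↔ Q f) →
      ((univ.filter fun f : Fin n → Fin k => Q f ∧ f v = f u).card : ℝ)
        = (k : ℝ)⁻¹ * (univ.filter Q).card := by
    intro Q u v huv hQ
    have := card_coordinate_mem v Q (fun f => {f u}) 1 hQ
      (fun f x => by rw [update_of_ne huv]) (by simp)
    simp only [mem_singleton, Fintype.card_fin, one_mul] at this
    have : ((univ.filter fun f : Fin n → Fin k => Q f ∧ f v = f u).card : ℝ) * k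
        = (univ.filter Q).card := by exact_mod_cast this
    rw [← this]
    field_simp
  have hsingle : ∀ u v : Fin n, u ≠ v →
      ((univ.filter fun f : Fin n → Fin k => f v = f u).card : ℝ)
        = (k : ℝ)⁻¹ * Fintype.card (Fin n → Fin k) := by
    intro u v huv
    have := hone (fun _ => True) u v huv (by simp)
    simpa only [true_and, filter_true, Finset.card_univ] using this
  have hdouble : ∀ x y u v : Fin n, x ≠ y → u ≠ v → v ≠ x → v ≠ y →
      ((univ.filter fun f : Fin n → Fin k => f y = f x ∧ f v = f u).card : ℝ)
        = (k : ℝ)⁻¹ ^ 2 * Fintype.card (Fin n → Fin k) := by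
    intro x y u v hxy huv hvx hvy
    rw [sq, mul_assoc, ← hsingle x y hxy]
    have := hone (fun f => f y = f x) u v huv
      (fun f z => by rw [update_of_ne hvx.symm, update_of_ne hvy.symm])
    convert this
  have hpair : ∀ q : {q : Fin n × Fin n // G.Adj q.1 q.2},
      ∃ E : Finset {q : Fin n × Fin n // G.Adj q.1 q.2}, E.card ≤ 2 ∧ ∀ q' ∉ E,
        ((univ.filter fun f : Fin n → Fin k => f q.1.2 = f q.1.1 ∧ f q'.1.2 = f q'.1.1).card : ℝ)
          = (k : ℝ)⁻¹ ^ 2 * Fintype.card (Fin n → Fin k) := by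
    intro q
    refine ⟨{q, ⟨q.1.swap, q.2.symm⟩}, card_le_two, ?_⟩
    rintro ⟨⟨u, v⟩, huv⟩ hq
    obtain ⟨⟨x, y⟩, hxy⟩ := q
    simp only [mem_insert, mem_singleton, Subtype.mk.injEq, Prod.swap_prod_mk, Prod.mk.injEq,
      not_or, not_and] at hq ⊢
    have huv' : u ≠ v := huv.ne
    have hxy' : x ≠ y := hxy.ne
    by_cases hv : v ≠ x ∧ v ≠ y
    · exact hdouble x y u v hxy' huv' hv.1 hv.2
    -- If both `u` and `v` lay on the first edge, the second would be that edge or its reversal. So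
    -- `u` can be revealed last instead.
    · have hu : u ≠ x ∧ u ≠ y := by grind
      rw [← hdouble x y v u hxy' huv'.symm hu.1 hu.2]
      simp only [eq_comm (a := (_ : Fin n → Fin k) v)]
  have hmain := card_deviation_mul_sq_le
    (fun (q : {q : Fin n × Fin n // G.Adj q.1 q.2}) (f : Fin n → Fin k) => f q.1.2 = f q.1.1)
    (k : ℝ)⁻¹ (by positivity) (fun q => by convert hsingle _ _ q.2.ne)
    (fun q => by convert hpair q) a ha
  rw [hI] at hmain
  simp only [monoCount_eq_card]
  convert hmain

end ISQuery

/-! ### The two kinds of trial and their consensus -/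

namespace ISQuery

open Finset QueryTree

open Classical in
/-- A value to which more than half of the given optional values are close, if there is one. -/
noncomputable def consensus (δ : ℝ) {t : ℕ} (r : Fin t → Option ℝ) : Option ℝ :=
  if h : ∃ x : ℝ, t < 2 * (univ.filter fun i => ∃ y ∈ r i, |y - x| ≤ δ * x).card
  then some h.choose else none

open Classical in
-- Two strict majorities intersect, so some reported value is close to both `x` and `m`. The errors
-- combine to `3 * δ` because `(1 + δ) / (1 - δ) ≤ 1 + 3 * δ` for `δ ≤ 1 / 3`.
lemma isApprox_of_consensus {δ m x : ℝ} (hδ : 0 < δ) (hδ1 : δ ≤ 1 / 3) (hm : 0 ≤ m) {t : ℕ}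
    {r : Fin t → Option ℝ}
    (h : t < 2 * (univ.filter fun i => ∀ y ∈ r i, |y - m| ≤ δ * m).card)
    (hx : consensus δ r = some x) : IsApprox (3 * δ) m x := by
  unfold consensus at hx
  split_ifs at hx with hex
  rw [Option.some.injEq] at hx
  have hs := hex.choose_spec
  rw [hx] at hs
  obtain ⟨i, hi⟩ : ((univ.filter fun i => ∃ y ∈ r i, |y - x| ≤ δ * x)
      ∩ univ.filter fun i => ∀ y ∈ r i, |y - m| ≤ δ * m).Nonempty := by
    apply inter_nonempty_of_card_lt_card_add_card (subset_univ _) (subset_univ _)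
    rw [Finset.card_univ, Fintype.card_fin]
    omega
  simp only [mem_inter, mem_filter, mem_univ, true_and] at hi
  obtain ⟨⟨y, hy, hyx⟩, hi⟩ := hi
  have hym := hi y hy
  rw [abs_le] at hyx hym
  have hδm : 0 ≤ δ * m := by positivity
  constructor
  · nlinarith
  · nlinarith

open Classical in
lemma consensus_ne_none {δ m : ℝ} {t : ℕ} {r : Fin t → Option ℝ}
    (h : t < 2 * (univ.filter fun i => ∃ y ∈ r i, |y - m| ≤ δ * m).card) :
    consensus δ r ≠ none := by
  unfold consensus
  rw [dif_pos ⟨m, h⟩]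
  simp

variable {n : ℕ}

/-- Estimate the number of edges from a sample of pairs of vertices, unless fewer than `2 * W` of
them are edges. -/
noncomputable def pairTrial (W s : ℕ) (x : Fin s → Fin n × Fin n) : QueryTree n (Option ℝ) :=
  (runAll fun i => ask {(x i).1, (x i).2} (pure 0) (pure 1)).bind fun r : Fin s → ℕ =>
    pure (if ∑ i, r i < 2 * W then none else some ((∑ i, r i : ℕ) * (n : ℝ) ^ 2 / (2 * s)))

/-- Estimate the number of edges from the number of monochromatic ones, unless counting these
takes more than `b` queries. -/
noncomputable def colorTrial (d b k : ℕ) (f : Fin n → Fin k) : QueryTree n (Option ℝ) :=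
  (limit b (runAll fun i => countDarts d (n * n) (colorClass f i))).bind fun o =>
    pure (o.map fun r => (k : ℝ) * (∑ i, r i : ℕ) / 2)

variable (G : SimpleGraph (Fin n))

lemma eval_pairTrial (W s : ℕ) (x : Fin s → Fin n × Fin n) :
    (pairTrial W s x).eval G = if sampleCount G x < 2 * W then none
      else some (sampleCount G x * (n : ℝ) ^ 2 / (2 * s)) := by
  classical
  have : ∀ i, (ask {(x i).1, (x i).2} (pure 0) (pure 1) : QueryTree n ℕ).eval G
      = if G.Adj (x i).1 (x i).2 then 1 else 0 := by
    intro i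
    rw [eval]
    by_cases h : G.Adj (x i).1 (x i).2
    · rw [if_pos h, if_neg]
      · rfl
      · exact fun hI => hI (by simp) (by simp) h.ne h
    · rw [if_neg h, if_pos]
      · rfl
      · intro u hu v hv huv huv'
        simp only [coe_insert, coe_singleton, Set.mem_insert_iff, Set.mem_singleton_iff] at hu hv
        rcases hu with rfl | rfl <;> rcases hv with rfl | rfl
        · exact huv rfl
        · exact h huv'
        · exact h huv'.symm
        · exact huv rfl
  simp only [pairTrial, eval_bind, eval_pure, eval_runAll, this, sampleCount, card_filter]

lemma cost_pairTrial (W s : ℕ) (x : Fin s → Fin n × Fin n) :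
    (pairTrial W s x).cost G = s := by
  simp [pairTrial, cost]

lemma cost_colorTrial_le (d b k : ℕ) (f : Fin n → Fin k) :
    (colorTrial d b k f).cost G ≤ b := by
  simpa [colorTrial] using cost_limit_le G b _

lemma adjCount_le (A : Finset (Fin n)) : adjCount G A A ≤ n * n := by
  have hA : A.card ≤ n := A.card_le_univ.trans_eq (Fintype.card_fin n)
  calc adjCount G A A ≤ ∑ u ∈ A, ∑ v ∈ A, 1 :=
        sum_le_sum fun u _ => sum_le_sum fun v _ => by split_ifs <;> simp
    _ = A.card * A.card := by simp
    _ ≤ n * n := Nat.mul_le_mul hA hA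

lemma eval_colorTrial {d : ℕ} (hd : n ≤ 2 ^ d) (b k : ℕ) (f : Fin n → Fin k) :
    (∀ y ∈ (colorTrial d b k f).eval G, y = k * monoCount G f / 2) ∧
      (k + (4 * d + 2) * monoCount G f ≤ b → (colorTrial d b k f).eval G ≠ none) := by
  have h := fun i => countDarts_spec G hd (n * n) (colorClass f i) (adjCount_le G _)
  have hc : ∑ i, (countDarts d (n * n) (colorClass f i)).cost G
      ≤ k + (4 * d + 2) * monoCount G f := by
    refine (sum_le_sum fun i _ => (h i).2).trans_eq ?_
    rw [sum_add_distrib, ← mul_sum, monoCount]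
    simp
  simp only [colorTrial, eval_bind, eval_pure, eval_limit, cost_runAll, eval_runAll]
  constructor
  · intro y hy
    split_ifs at hy
    · simp only [Option.map_some, Option.mem_def, Option.some.injEq] at hy
      rw [← hy, monoCount]
      simp only [fun i => (h i).1]
    · simp at hy
  · intro hb
    rw [if_pos (hc.trans hb)]
    simp

open Classical in
-- Chebyshev with a threshold `a` satisfying `64 * μ ≤ a ^ 2` fails with probability at most 1/32.
-- The cutoff `2 * W` makes the trial abstain when the mean is too small for relative accuracy.
lemma pairTrial_bad_le {δ : ℝ} (hδ : 0 < δ) (hδ1 : δ ≤ 1 / 3) {W : ℕ} (hW : 64 ≤ δ ^ 2 * W)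
    (hn : 0 < n) (j : ℕ) :
    (univ.filter fun x : Fin (2 ^ j * W) → Fin n × Fin n =>
      ¬((∀ y ∈ (pairTrial W _ x).eval G, |y - numEdges G| ≤ δ * numEdges G) ∧
        (2 * n ^ 2 ≤ 2 ^ j * numEdges G → (pairTrial W _ x).eval G ≠ none))).card * 32
      ≤ Fintype.card (Fin (2 ^ j * W) → Fin n × Fin n) := by
  set s := 2 ^ j * W with hs
  set m := numEdges G
  have hn' : (0 : ℝ) < n := by exact_mod_cast hn
  have hW64 : (64 : ℝ) ≤ W := by nlinarith
  have hs0 : (0 : ℝ) < s := by rw [hs]; push_cast; positivity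
  set μ : ℝ := s * (2 * m / n ^ 2) with hμ
  have hμm : μ * (n : ℝ) ^ 2 / (2 * s) = m := by rw [hμ]; field_simp
  have hterm : 2 * n ^ 2 ≤ 2 ^ j * m → 4 * (W : ℝ) ≤ μ := by
    intro h
    have h' : 2 * (n : ℝ) ^ 2 ≤ 2 ^ j * m := by exact_mod_cast h
    rw [hμ, hs, ← mul_div_assoc, le_div_iff₀ (by positivity)]
    push_cast
    nlinarith
  have hμ0 : 0 ≤ μ := by positivity
  suffices h : ∃ a : ℝ, 0 < a ∧ 64 * μ ≤ a ^ 2 ∧ ∀ x : Fin s → Fin n × Fin n,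
      |(sampleCount G x : ℝ) - μ| < a →
        ((∀ y ∈ (pairTrial W _ x).eval G, |y - m| ≤ δ * m) ∧
          (2 * n ^ 2 ≤ 2 ^ j * m → (pairTrial W _ x).eval G ≠ none)) by
    obtain ⟨a, ha, haμ, hx⟩ := h
    have hdev := sampleCount_deviation G hn s a ha.le
    have hle := card_le_card (monotone_filter_right univ (p := fun x : Fin s → Fin n × Fin n =>
      ¬((∀ y ∈ (pairTrial W _ x).eval G, |y - m| ≤ δ * m) ∧
          (2 * n ^ 2 ≤ 2 ^ j * m → (pairTrial W _ x).eval G ≠ none)))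
      (q := fun x => a ≤ |(sampleCount G x : ℝ) - μ|)
      fun x _ h1 => not_lt.1 fun h2 => h1 (hx x h2))
    refine (Nat.mul_le_mul_right 32 hle).trans ?_
    rw [← Nat.cast_le (α := ℝ), Nat.cast_mul]
    refine le_of_mul_le_mul_right ?_ (by positivity : 0 < a ^ 2)
    push_cast at hdev ⊢
    nlinarith [mul_le_mul_of_nonneg_right haμ
      (Nat.cast_nonneg (α := ℝ) (Fintype.card (Fin s → Fin n × Fin n)))]
  -- If `W ≤ μ`, then `a = δ * μ` gives relative accuracy, and a mean of at least `4 * W` clears the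
  -- cutoff. If `μ < W`, then `a = W` keeps the count below `2 * W`, so the trial abstains.
  rcases le_or_gt (W : ℝ) μ with hμW | hμW
  · refine ⟨δ * μ, by nlinarith, by nlinarith [mul_le_mul_of_nonneg_left hμW (sq_nonneg δ)], ?_⟩
    intro x hx
    rw [eval_pairTrial]
    rw [abs_lt] at hx
    constructor
    · intro y hy
      split_ifs at hy
      · simp at hy
      · rw [Option.mem_def, Option.some.injEq] at hy
        have hc : (0 : ℝ) < n ^ 2 / (2 * s) := by positivity
        rw [← hy, ← hμm, abs_le]
        have e1 : (sampleCount G x : ℝ) * (n : ℝ) ^ 2 / (2 * s) - μ * (n : ℝ) ^ 2 / (2 * s)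
          = (sampleCount G x - μ) * (n ^ 2 / (2 * s)) := by ring
        have e2 : δ * (μ * (n : ℝ) ^ 2 / (2 * s)) = (δ * μ) * (n ^ 2 / (2 * s)) := by ring
        rw [e1, e2]
        constructor <;> nlinarith
    · intro h
      have := hterm h
      rw [if_neg]
      · simp
      · rw [not_lt, ← Nat.cast_le (α := ℝ)]
        push_cast
        nlinarith
  · refine ⟨W, by linarith, by nlinarith, ?_⟩
    intro x hx
    rw [abs_lt] at hx
    constructor
    · rw [eval_pairTrial, if_pos]
      · simp
      · rw [← Nat.cast_lt (α := ℝ)]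
        push_cast
        linarith
    · intro h
      have := hterm h
      linarith

open Classical in
lemma colorTrial_bad_le {δ : ℝ} (hδ : 0 < δ) (hδ1 : δ ≤ 1 / 3) {W : ℕ} (hW : 64 ≤ δ ^ 2 * W)
    {d : ℕ} (hd : n ≤ 2 ^ d) {k : ℕ} (hk : 0 < k) (hm : W ^ 2 ≤ numEdges G)
    (hj : k ^ 2 ≤ 4 * numEdges G) :
    (univ.filter fun f : Fin n → Fin k =>
      ¬((∀ y ∈ (colorTrial d (k * (1 + 4 * (4 * d + 2))) k f).eval G,
          |y - numEdges G| ≤ δ * numEdges G) ∧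
        (numEdges G ≤ k ^ 2 →
          (colorTrial d (k * (1 + 4 * (4 * d + 2))) k f).eval G ≠ none))).card * 32
      ≤ Fintype.card (Fin n → Fin k) := by
  set m := numEdges G
  have hk' : (0 : ℝ) < k := by exact_mod_cast hk
  have hjR : (k : ℝ) ^ 2 ≤ 4 * m := by exact_mod_cast hj
  have hmR : (W : ℝ) ^ 2 ≤ m := by exact_mod_cast hm
  have hW64 : (64 : ℝ) ≤ W := by nlinarith
  set μ : ℝ := 2 * m / k with hμ
  have hμk : μ * k = 2 * m := by rw [hμ]; field_simp
  -- This is where failure of exact counting is used: `W ^ 2 ≤ m` and `k ^ 2 ≤ 4 * m` give `W * k ≤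
  -- 2 * m`.
  have hμW : (W : ℝ) ≤ μ := by
    rw [hμ, le_div_iff₀ hk']
    refine le_of_sq_le_sq ?_ (by positivity)
    rw [mul_pow]
    nlinarith [mul_le_mul hmR hjR (by positivity) (by positivity)]
  have hμ0 : 0 < μ := by linarith
  have ha : 0 < δ * μ := by positivity
  have haμ : 64 * μ ≤ (δ * μ) ^ 2 := by nlinarith [mul_le_mul_of_nonneg_left hμW (sq_nonneg δ)]
  have hgood : ∀ f : Fin n → Fin k, |(monoCount G f : ℝ) - μ| < δ * μ →
      ((∀ y ∈ (colorTrial d (k * (1 + 4 * (4 * d + 2))) k f).eval G, |y - m| ≤ δ * m) ∧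
        (m ≤ k ^ 2 → (colorTrial d (k * (1 + 4 * (4 * d + 2))) k f).eval G ≠ none)) := by
    intro f hf
    rw [abs_lt] at hf
    obtain ⟨h1, h2⟩ := eval_colorTrial G hd (k * (1 + 4 * (4 * d + 2))) k f
    constructor
    · intro y hy
      rw [h1 y hy, abs_le]
      constructor <;> nlinarith
    · intro hmk
      apply h2
      have hmk' : (m : ℝ) ≤ k ^ 2 := by exact_mod_cast hmk
      -- The query budget is set for this bound: the count is below `(1 + δ) * μ ≤ (4 / 3) * (2 *
      -- k)`.
      have hX : (monoCount G f : ℝ) ≤ 4 * k := by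
        have : μ ≤ 2 * k := by
          rw [hμ, div_le_iff₀ hk']
          nlinarith
        nlinarith
      have hX' : monoCount G f ≤ 4 * k := by exact_mod_cast hX
      nlinarith [Nat.mul_le_mul_left (4 * d + 2) hX']
  have hdev := monoCount_deviation G k hk (δ * μ) ha.le
  have hle := card_le_card (monotone_filter_right univ (p := fun f : Fin n → Fin k =>
      ¬((∀ y ∈ (colorTrial d (k * (1 + 4 * (4 * d + 2))) k f).eval G, |y - m| ≤ δ * m) ∧
        (m ≤ k ^ 2 → (colorTrial d (k * (1 + 4 * (4 * d + 2))) k f).eval G ≠ none)))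
      (q := fun f => δ * μ ≤ |(monoCount G f : ℝ) - μ|)
      fun f _ h1 => not_lt.1 fun h2 => h1 (hgood f h2))
  refine (Nat.mul_le_mul_right 32 hle).trans ?_
  rw [← Nat.cast_le (α := ℝ), Nat.cast_mul]
  refine le_of_mul_le_mul_right ?_ (by positivity : 0 < (δ * μ) ^ 2)
  push_cast at hdev ⊢
  nlinarith [mul_le_mul_of_nonneg_right haμ
    (Nat.cast_nonneg (α := ℝ) (Fintype.card (Fin n → Fin k)))]

end ISQuery

/-! ### Rounds and the full estimator -/

namespace ISQuery

open Finset QueryTree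

variable {n : ℕ}

/-- The randomness of one trial in round `j`: a sample of pairs of vertices and a colouring. -/
abbrev TrialSeed (n W j : ℕ) : Type :=
  (Fin (2 ^ j * W) → Fin n × Fin n) × (Fin n → Fin (2 ^ j))

/-- One trial by sampling and one by colouring. -/
noncomputable def trial (d : ℕ) {W j : ℕ} (q : TrialSeed n W j) :
    QueryTree n (Option ℝ × Option ℝ) :=
  (pairTrial W _ q.1).bind fun a =>
    (colorTrial d (2 ^ j * (1 + 4 * (4 * d + 2))) (2 ^ j) q.2).bind fun b => pure (a, b)

/-- Make `t` trials, looking for a consensus of the sampling trials, or else of the colouring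
trials. -/
noncomputable def round (δ : ℝ) (d : ℕ) {W j t : ℕ} (q : Fin t → TrialSeed n W j) :
    QueryTree n (Option ℝ) :=
  (runAll fun i => trial d (q i)).bind fun r => pure
    ((consensus δ fun i => (r i).1).elim (consensus δ fun i => (r i).2) some)

/-- The estimator: try to count the edges exactly within a limited number of queries; if this
fails, run the rounds in turn. -/
noncomputable def edgeEstimator (δ : ℝ) (d W : ℕ) {J t : ℕ}
    (q : ∀ j : Fin J, Fin t → TrialSeed n W j) : QueryTree n ℝ :=
  (limit (1 + (4 * d + 2) * (2 * W ^ 2)) (countDarts d (n * n) univ)).bind fun o =>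
    o.elim (search fun j => round δ d (q j)) fun D => pure (D / 2)

variable (G : SimpleGraph (Fin n))

/-- Both parts of a trial are accurate or fail, and each part succeeds in the rounds where this is
expected. -/
def GoodTrial (δ : ℝ) (d : ℕ) {W j : ℕ} (q : TrialSeed n W j) : Prop :=
  ((∀ y ∈ (pairTrial W _ q.1).eval G, |y - numEdges G| ≤ δ * numEdges G) ∧
    (2 * n ^ 2 ≤ 2 ^ j * numEdges G → (pairTrial W _ q.1).eval G ≠ none)) ∧
  ((∀ y ∈ (colorTrial d (2 ^ j * (1 + 4 * (4 * d + 2))) (2 ^ j) q.2).eval G,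
      |y - numEdges G| ≤ δ * numEdges G) ∧
    (numEdges G ≤ (2 ^ j) ^ 2 → (colorTrial d (2 ^ j * (1 + 4 * (4 * d + 2))) (2 ^ j) q.2).eval G ≠ none))

open Classical in
lemma trial_bad_le {δ : ℝ} (hδ : 0 < δ) (hδ1 : δ ≤ 1 / 3) {W : ℕ} (hW : 64 ≤ δ ^ 2 * W)
    {d : ℕ} (hn : 0 < n) (hd : n ≤ 2 ^ d) {j : ℕ} (hm : W ^ 2 ≤ numEdges G)
    (hj : (2 ^ j) ^ 2 ≤ 4 * numEdges G) :
    (univ.filter fun q : TrialSeed n W j => ¬GoodTrial G δ d q).card * 16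
      ≤ Fintype.card (TrialSeed n W j) := by
  have hA := pairTrial_bad_le G hδ hδ1 hW hn j
  have hB := colorTrial_bad_le G hδ hδ1 hW hd (Nat.two_pow_pos j) hm hj
  set A := univ.filter fun x : Fin (2 ^ j * W) → Fin n × Fin n =>
      ¬((∀ y ∈ (pairTrial W _ x).eval G, |y - numEdges G| ≤ δ * numEdges G) ∧
        (2 * n ^ 2 ≤ 2 ^ j * numEdges G → (pairTrial W _ x).eval G ≠ none)) with hAdef
  set B := univ.filter fun f : Fin n → Fin (2 ^ j) =>
      ¬((∀ y ∈ (colorTrial d (2 ^ j * (1 + 4 * (4 * d + 2))) (2 ^ j) f).eval G,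
          |y - numEdges G| ≤ δ * numEdges G) ∧
        (numEdges G ≤ (2 ^ j) ^ 2 →
          (colorTrial d (2 ^ j * (1 + 4 * (4 * d + 2))) (2 ^ j) f).eval G ≠ none)) with hBdef
  have hsub : (univ.filter fun q : TrialSeed n W j => ¬GoodTrial G δ d q)
      ⊆ A ×ˢ univ ∪ univ ×ˢ B := by
    intro q hq
    rw [mem_filter, GoodTrial, not_and_or] at hq
    rw [mem_union, mem_product, mem_product, hAdef, hBdef, mem_filter, mem_filter]
    exact hq.2.imp (fun h => ⟨⟨mem_univ _, h⟩, mem_univ _⟩) fun h => ⟨mem_univ _, mem_univ _, h⟩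
  have hc := (card_le_card hsub).trans (card_union_le _ _)
  rw [card_product, card_product, Finset.card_univ, Finset.card_univ] at hc
  rw [Fintype.card_prod]
  have h1 := Nat.mul_le_mul_right (Fintype.card (Fin n → Fin (2 ^ j))) hA
  have h2 := Nat.mul_le_mul_left (Fintype.card (Fin (2 ^ j * W) → Fin n × Fin n)) hB
  linarith

open Classical in
-- Good trials form a strict majority, so any consensus is accurate; in the rounds where good trials
-- must answer, they themselves produce one.
lemma round_spec {δ : ℝ} (hδ : 0 < δ) (hδ1 : δ ≤ 1 / 3) {d W j t : ℕ}
    (q : Fin t → TrialSeed n W j)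
    (h : ¬t ≤ 2 * (univ.filter fun i => ¬GoodTrial G δ d (q i)).card) :
    (∀ x, (round δ d q).eval G = some x → IsApprox (3 * δ) (numEdges G) x) ∧
      (2 * n ^ 2 ≤ 2 ^ j * numEdges G ∨ numEdges G ≤ (2 ^ j) ^ 2 → (round δ d q).eval G ≠ none) := by
  have hgood : t < 2 * (univ.filter fun i => GoodTrial G δ d (q i)).card := by
    have := card_filter_add_card_filter_not (s := univ) fun i => GoodTrial G δ d (q i)
    rw [Finset.card_univ, Fintype.card_fin] at this
    omega
  have key : ∀ (p : Fin t → Prop) [DecidablePred p], (∀ i, GoodTrial G δ d (q i) → p i) →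
      t < 2 * (univ.filter p).card := fun p _ hp =>
    hgood.trans_le (Nat.mul_le_mul_left 2
      (card_le_card (monotone_filter_right univ fun i _ => hp i)))
  simp only [round, trial, eval_bind, eval_pure, eval_runAll]
  constructor
  · intro x hx
    cases hc : consensus δ fun i => (pairTrial W _ (q i).1).eval G with
    | some y =>
      rw [hc] at hx
      obtain rfl : y = x := by simpa using hx
      exact isApprox_of_consensus hδ hδ1 (Nat.cast_nonneg _) (@key _ _ fun i hi => hi.1.1) hc
    | none =>
      rw [hc] at hx
      exact isApprox_of_consensus hδ hδ1 (Nat.cast_nonneg _) (@key _ _ fun i hi => hi.2.1) hx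
  · intro hor
    cases hc : consensus δ fun i => (pairTrial W _ (q i).1).eval G with
    | some y => simp
    | none =>
      rcases hor with hor | hor
      · refine absurd hc (consensus_ne_none (m := numEdges G) (@key _ _ fun i hi => ?_))
        obtain ⟨y, hy⟩ := Option.ne_none_iff_exists'.1 (hi.1.2 hor)
        exact ⟨y, hy, hi.1.1 y hy⟩
      · refine consensus_ne_none (m := numEdges G) (@key _ _ fun i hi => ?_)
        obtain ⟨y, hy⟩ := Option.ne_none_iff_exists'.1 (hi.2.2 hor)
        exact ⟨y, hy, hi.2.1 y hy⟩

lemma cost_round_le (δ : ℝ) {d W j t : ℕ} (q : Fin t → TrialSeed n W j) :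
    (round δ d q).cost G ≤ t * (W + (1 + 4 * (4 * d + 2))) * 2 ^ j := by
  simp only [round, trial, cost_bind, cost_pure, cost_runAll, cost_pairTrial, add_zero]
  refine (sum_le_card_nsmul _ _ (2 ^ j * W + 2 ^ j * (1 + 4 * (4 * d + 2))) fun i _ =>
    Nat.add_le_add_left (cost_colorTrial_le G _ _ _ _) _).trans_eq ?_
  rw [Finset.card_univ, Fintype.card_fin, smul_eq_mul]
  ring

lemma numEdges_le_sq : numEdges G ≤ n ^ 2 := by
  have := adjCount_le G univ
  rw [adjCount_univ] at this
  nlinarith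

/-- The outcome wanted from the estimator. -/
def GoodOutcome (δ : ℝ) (d W t : ℕ) (T : QueryTree n ℝ) : Prop :=
  IsApprox (3 * δ) (numEdges G) (T.eval G) ∧
    (T.cost G : ℝ) ≤ (1 + (4 * d + 2) * (2 * W ^ 2) : ℕ)
      + 8 * (t * (W + (1 + 4 * (4 * d + 2))) : ℕ)
        * min (Real.sqrt (numEdges G)) ((n : ℝ) ^ 2 / numEdges G)

open Classical in
lemma edgeEstimator_bad_le {δ : ℝ} (hδ : 0 < δ) (hδ1 : δ ≤ 1 / 3) {W : ℕ} (hW : 64 ≤ δ ^ 2 * W)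
    {d : ℕ} (hn : 0 < n) (hd : n ≤ 2 ^ d) (t : ℕ) :
    (univ.filter fun q : ∀ j : Fin (d + 1), Fin t → TrialSeed n W j =>
      ¬GoodOutcome G δ d W t (edgeEstimator δ d W q)).card * 2 ^ t
      ≤ (d + 1) * Fintype.card (∀ j : Fin (d + 1), Fin t → TrialSeed n W j) := by
  have : NeZero n := ⟨hn.ne'⟩
  set m := numEdges G with hm
  obtain ⟨he, hc⟩ := countDarts_spec G hd (n * n) univ (adjCount_le G _)
  rw [adjCount_univ, ← hm] at he hc
  by_cases hb : (countDarts d (n * n) (univ : Finset (Fin n))).cost G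
      ≤ 1 + (4 * d + 2) * (2 * W ^ 2)
  · have hall : ∀ q : ∀ j : Fin (d + 1), Fin t → TrialSeed n W j,
        GoodOutcome G δ d W t (edgeEstimator δ d W q) := by
      intro q
      unfold GoodOutcome
      simp only [edgeEstimator, eval_bind, cost_bind, eval_limit, if_pos hb, Option.elim,
        eval_pure, cost_pure, he, ← hm]
      constructor
      · have : (0 : ℝ) ≤ 3 * δ * m := by positivity
        constructor <;> push_cast <;> linarith
      · have hl := cost_limit_le G (1 + (4 * d + 2) * (2 * W ^ 2))
          (countDarts d (n * n) (univ : Finset (Fin n)))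
        rw [add_zero]
        refine (Nat.cast_le.2 hl).trans (le_add_of_nonneg_right ?_)
        positivity
    rw [filter_false_of_mem fun q _ => not_not.2 (hall q), card_empty, zero_mul]
    exact Nat.zero_le _
  -- Exact counting of `2 * m` ordered pairs fits in the budget whenever `m ≤ W ^ 2`.
  have hWm : W ^ 2 ≤ m := by
    by_contra hlt
    push Not at hlt
    have := Nat.mul_le_mul_left (4 * d + 2) hlt.le
    exact hb (hc.trans (by nlinarith))
  have hWpos : 0 < W := by
    rcases Nat.eq_zero_or_pos W with rfl | h
    · norm_num at hW
    · exact h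
  have hm1 : 1 ≤ m := le_trans (Nat.one_le_pow _ _ hWpos) hWm
  have hmn : m ≤ n ^ 2 := numEdges_le_sq G
  -- The first scale at which a trial must succeed; it is at most `d` because `m ≤ n ^ 2`. By
  -- minimality both conditions fail one scale earlier, which bounds `2 ^ k` by four times the
  -- minimum.
  have hex : ∃ j : ℕ, 2 * n ^ 2 ≤ 2 ^ j * m ∨ m ≤ (2 ^ j) ^ 2 := by
    exact ⟨d, Or.inr (hmn.trans (Nat.pow_le_pow_left hd 2))⟩
  set k := Nat.find hex with hk
  have hkd : k ≤ d := by
    exact Nat.find_min' hex (Or.inr (hmn.trans (Nat.pow_le_pow_left hd 2)))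
  have hkspec := Nat.find_spec hex
  rw [← hk] at hkspec
  have hkmin : ∀ j < k, 2 ^ j * m < 2 * n ^ 2 ∧ (2 ^ j) ^ 2 < m := fun j hj => by
    have := Nat.find_min hex hj
    push Not at this
    exact this
  have h4 : ∀ j ≤ k, (2 ^ j) ^ 2 ≤ 4 * m := by
    intro j hj
    cases j with
    | zero => rw [pow_zero, one_pow]; omega
    | succ j =>
      have := (hkmin j hj).2
      rw [pow_succ 2 j, mul_pow]
      omega
  have h2 : (2 : ℝ) ^ k * m ≤ 4 * n ^ 2 := by
    have : 2 ^ k * m ≤ 4 * n ^ 2 := by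
      rcases Nat.eq_zero_or_pos k with h0 | h0
      · rw [h0, pow_zero]; omega
      · obtain ⟨l, hl⟩ := Nat.exists_eq_succ_of_ne_zero h0.ne'
        have := (hkmin l (by omega)).1
        rw [hl, pow_succ]
        nlinarith
    exact_mod_cast this
  have hmR : (0 : ℝ) < m := by exact_mod_cast hm1
  have hkmin' : (2 : ℝ) ^ k ≤ 4 * min (Real.sqrt m) ((n : ℝ) ^ 2 / m) := by
    rw [mul_min_of_nonneg _ _ (by norm_num : (0 : ℝ) ≤ 4), le_min_iff]
    constructor
    · have : (2 : ℝ) ^ k ≤ Real.sqrt (4 * m) :=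
        Real.le_sqrt_of_sq_le (by exact_mod_cast h4 k le_rfl)
      refine this.trans ?_
      rw [Real.sqrt_mul (by norm_num), show (4 : ℝ) = 2 ^ 2 by norm_num,
        Real.sqrt_sq (by norm_num)]
      have := Real.sqrt_nonneg (m : ℝ)
      linarith
    · rw [← mul_div_assoc, le_div_iff₀ hmR]
      exact h2
  -- Only rounds up to `k` enter the union bound. Later ones may violate `(2 ^ j) ^ 2 ≤ 4 * m`,
  -- which concentration needs, but they are not reached.
  obtain ⟨bad, hbad⟩ : ∃ bad : ∀ j : Fin (d + 1), (Fin t → TrialSeed n W j) → Prop,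
      ∀ j q, bad j q ↔ (j : ℕ) ≤ k ∧
        t ≤ 2 * (univ.filter fun i => ¬GoodTrial G δ d (q i)).card := ⟨_, fun _ _ => Iff.rfl⟩
  have hcard : ∀ j, (univ.filter (bad j)).card * 2 ^ t
      ≤ Fintype.card (Fin t → TrialSeed n W j) := by
    intro j
    by_cases hj : (j : ℕ) ≤ k
    · have htrial := trial_bad_le G hδ hδ1 hW hn hd hWm (h4 j hj)
      have := card_majority_bad_le (fun q : TrialSeed n W j => ¬GoodTrial G δ d q)
        (by convert htrial) t
      convert this using 7
      rw [hbad, and_iff_right hj]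
      congr!
    · rw [filter_false_of_mem fun q _ hq => hj ((hbad j q).1 hq).1, card_empty, zero_mul]
      exact Nat.zero_le _
  have hall := card_exists_bad_le (Ω := fun j : Fin (d + 1) => Fin t → TrialSeed n W j)
    bad (2 ^ t) hcard
  refine le_trans (Nat.mul_le_mul_right _ (card_le_card ?_)) hall
  · intro q hq
    rw [mem_filter] at hq ⊢
    refine ⟨mem_univ _, ?_⟩
    replace hq := hq.2
    by_contra hgood
    simp only [hbad] at hgood
    push Not at hgood
    have hround := fun (j : Fin (d + 1)) (hj : (j : ℕ) ≤ k) =>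
      round_spec G hδ hδ1 (q j) (not_le.2 (hgood j hj))
    obtain ⟨happ, hcost⟩ := search_spec G (fun j => round δ d (q j)) (IsApprox (3 * δ) m)
      ⟨k, Nat.lt_succ_of_le hkd⟩ (t * (W + (1 + 4 * (4 * d + 2))))
      (fun j => cost_round_le G δ (q j)) (fun j hj => (hround j hj).1)
      ((hround _ le_rfl).2 hkspec)
    refine hq ?_
    unfold GoodOutcome
    simp only [edgeEstimator, eval_bind, cost_bind, eval_limit, if_neg hb, Option.elim, ← hm]
    refine ⟨happ, ?_⟩
    have hl := cost_limit_le G (1 + (4 * d + 2) * (2 * W ^ 2))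
      (countDarts d (n * n) (univ : Finset (Fin n)))
    rw [Nat.cast_add]
    refine add_le_add (Nat.cast_le.2 hl) ?_
    have hcost' := le_trans (Nat.le_add_right _ _) hcost
    rw [pow_succ] at hcost'
    refine (Nat.cast_le (α := ℝ).2 hcost').trans ?_
    set β := t * (W + (1 + 4 * (4 * d + 2)))
    rw [Nat.cast_mul]
    push_cast
    nlinarith [mul_le_mul_of_nonneg_left hkmin' (Nat.cast_nonneg (α := ℝ) β)]

end ISQuery

/-! ### The randomized algorithm and its constants -/

namespace ISQuery

open Finset QueryTree

/-- The sample size parameter for accuracy `ε`. -/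
noncomputable def sampleParam (ε : ℝ) : ℕ := ⌈576 / ε ^ 2⌉₊

/-- The number of trials in a round. -/
noncomputable def numTrials (c : ℝ) (n : ℕ) : ℕ := Nat.clog 2 n * ⌈c + 4⌉₊

open Classical in
/-- The estimator with its random choices drawn uniformly; for `1 ≤ ε` the estimate `0` is
always good enough. -/
noncomputable def algorithm (c : ℝ) (n : ℕ) (ε : ℝ) : RandomizedAlgorithm n :=
  if h : 2 ≤ n ∧ ε < 1 then
    haveI : NeZero n := ⟨by omega⟩
    (PMF.uniformOfFintype (∀ j : Fin (Nat.clog 2 n + 1),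
      Fin (numTrials c n) → TrialSeed n (sampleParam ε) j)).map
        fun q => (edgeEstimator (ε / 3) (Nat.clog 2 n) (sampleParam ε) q).toDecisionTree
  else PMF.pure (.output 0)

open Classical in
lemma le_toOuterMeasure_map_uniformOfFintype {Ω β : Type} [Fintype Ω] [Nonempty Ω] (f : Ω → β)
    (S : Set β) (bad : Ω → Prop) [DecidablePred bad] (hS : ∀ ω, ¬bad ω → f ω ∈ S) (p : ℝ)
    (h : ((univ.filter bad).card : ℝ) ≤ p * Fintype.card Ω) :
    ENNReal.ofReal (1 - p) ≤ ((PMF.uniformOfFintype Ω).map f).toOuterMeasure S := by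
  rw [PMF.toOuterMeasure_map_apply, PMF.toOuterMeasure_uniformOfFintype_apply]
  have hN : (0 : ℝ) < Fintype.card Ω := by exact_mod_cast Fintype.card_pos (α := Ω)
  have hsum : (Fintype.card Ω : ℝ) ≤ (univ.filter bad).card + Fintype.card (f ⁻¹' S) := by
    rw [Fintype.card_subtype, ← Finset.card_univ,
      ← card_filter_add_card_filter_not (s := (univ : Finset Ω)) bad, Nat.cast_add]
    refine add_le_add_right (Nat.cast_le.2 (card_le_card fun ω hω => ?_)) _
    rw [mem_filter] at hω ⊢
    exact ⟨hω.1, hS ω hω.2⟩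
  rw [← ENNReal.ofReal_natCast, ← ENNReal.ofReal_natCast (Fintype.card Ω),
    ← ENNReal.ofReal_div_of_pos hN]
  apply ENNReal.ofReal_le_ofReal
  rw [le_div_iff₀ hN]
  linarith

lemma one_le_logb {n : ℕ} (hn : 2 ≤ n) : 1 ≤ Real.logb 2 n := by
  rw [Real.le_logb_iff_rpow_le (by norm_num) (by positivity), Real.rpow_one]
  exact_mod_cast hn

lemma clog_le_two_mul_logb {n : ℕ} (hn : 2 ≤ n) : (Nat.clog 2 n : ℝ) ≤ 2 * Real.logb 2 n := by
  have h := one_le_logb hn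
  have := Nat.ceil_lt_add_one (zero_le_one.trans h)
  rw [← Real.natCeil_logb_natCast]
  push_cast
  linarith

/-- The union bound over `clog 2 n + 1 ≤ n ^ 4` rounds accounts for the 4 in the number of trials.
-/
lemma clog_add_one_mul_rpow_le {c : ℝ} {n : ℕ} (hn : 2 ≤ n) :
    ((Nat.clog 2 n + 1 : ℕ) : ℝ) * (n : ℝ) ^ c ≤ 2 ^ numTrials c n := by
  have hn1 : (1 : ℝ) ≤ n := by exact_mod_cast (by omega : 1 ≤ n)
  have h1 : Nat.clog 2 n + 1 ≤ n ^ 4 := by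
    have : Nat.clog 2 n ≤ n := Nat.clog_le_of_le_pow n.lt_two_pow_self.le
    have : n ^ 1 * 2 ^ 3 ≤ n ^ 1 * n ^ 3 := Nat.mul_le_mul_left _ (Nat.pow_le_pow_left hn 3)
    rw [← pow_add, pow_one] at this
    norm_num at this
    omega
  calc ((Nat.clog 2 n + 1 : ℕ) : ℝ) * (n : ℝ) ^ c ≤ (n : ℝ) ^ (4 : ℝ) * (n : ℝ) ^ c := by
        refine mul_le_mul_of_nonneg_right ?_ (by positivity)
        rw [show (4 : ℝ) = (4 : ℕ) by norm_num, Real.rpow_natCast]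
        exact_mod_cast h1
    _ = (n : ℝ) ^ (c + 4) := by rw [← Real.rpow_add (by linarith), add_comm]
    _ ≤ (n : ℝ) ^ ((⌈c + 4⌉₊ : ℕ) : ℝ) :=
        Real.rpow_le_rpow_of_exponent_le hn1 (Nat.le_ceil _)
    _ = (n : ℝ) ^ ⌈c + 4⌉₊ := Real.rpow_natCast _ _
    _ ≤ ((2 : ℝ) ^ Nat.clog 2 n) ^ ⌈c + 4⌉₊ := by
        gcongr
        exact_mod_cast Nat.le_pow_clog one_lt_two n
    _ = 2 ^ numTrials c n := by rw [← pow_mul, numTrials]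

/-- Everything is absorbed using `1 ≤ log n` and `1 ≤ ε⁻²`. In particular `ε⁻² + log n` is at most a
multiple of `ε⁻² log n`, and the number of trials supplies the second logarithm. -/
lemma cost_bound_le {c ε : ℝ} {n : ℕ} (hn : 2 ≤ n) (hε : 0 < ε) (hε1 : ε < 1) (m : ℕ) :
    ((1 + (4 * Nat.clog 2 n + 2) * (2 * sampleParam ε ^ 2) : ℕ) : ℝ)
      + 8 * (numTrials c n * (sampleParam ε + (1 + 4 * (4 * Nat.clog 2 n + 2))) : ℕ)
        * min (Real.sqrt m) ((n : ℝ) ^ 2 / m)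
      ≤ (25 * 577 ^ 2 + 10016 * ⌈c + 4⌉₊) * queryBound n ε m := by
  have hlg := one_le_logb hn
  have hL := clog_le_two_mul_logb hn
  rw [queryBound]
  set lg := Real.logb 2 n
  set L := Nat.clog 2 n
  set E : ℝ := (ε ^ 2)⁻¹ with hE
  have hE1 : 1 ≤ E := (one_le_inv₀ (by positivity)).2 (pow_le_one₀ hε.le hε1.le)
  have hE2 : (ε ^ 4)⁻¹ = E ^ 2 := by rw [hE, inv_pow, ← pow_mul]
  have hW : (sampleParam ε : ℝ) ≤ 577 * E := by
    have : (sampleParam ε : ℝ) < 576 / ε ^ 2 + 1 := Nat.ceil_lt_add_one (by positivity)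
    rw [div_eq_mul_inv, ← hE] at this
    linarith
  rw [hE2]
  set M := min (Real.sqrt m) ((n : ℝ) ^ 2 / m)
  have hM : 0 ≤ M := le_min (Real.sqrt_nonneg _) (by positivity)
  have hL5 : lg ≤ lg ^ 5 := le_self_pow₀ hlg (by norm_num)
  have hEl : 1 ≤ E * lg := one_le_mul_of_one_le_of_one_le hE1 hlg
  have hElE : E ≤ E * lg := le_mul_of_one_le_right (by linarith) hlg
  have hEll : lg ≤ E * lg := le_mul_of_one_le_left (by linarith) hE1
  have h1 : ((1 + (4 * L + 2) * (2 * sampleParam ε ^ 2) : ℕ) : ℝ)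
      ≤ 25 * 577 ^ 2 * (E ^ 2 * lg ^ 5) := by
    push_cast
    have hW2 : (sampleParam ε : ℝ) ^ 2 ≤ 577 ^ 2 * E ^ 2 := by
      rw [← mul_pow]
      exact pow_le_pow_left₀ (Nat.cast_nonneg _) hW 2
    have hE2' : 1 ≤ E ^ 2 := one_le_pow₀ hE1
    calc (1 : ℝ) + (4 * L + 2) * (2 * sampleParam ε ^ 2)
        ≤ 1 + (10 * lg) * (2 * (577 ^ 2 * E ^ 2)) := by gcongr; linarith
      _ ≤ 25 * 577 ^ 2 * (E ^ 2 * lg) := by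
        have : 1 ≤ E ^ 2 * lg := one_le_mul_of_one_le_of_one_le hE2' hlg
        nlinarith
      _ ≤ _ := by gcongr
  have h2 : 8 * ((numTrials c n * (sampleParam ε + (1 + 4 * (4 * L + 2))) : ℕ) : ℝ)
      ≤ 10016 * ⌈c + 4⌉₊ * (E * lg ^ 2) := by
    rw [numTrials]
    push_cast
    calc 8 * ((L : ℝ) * ⌈c + 4⌉₊ * (sampleParam ε + (1 + 4 * (4 * L + 2))))
        ≤ 8 * ((2 * lg) * ⌈c + 4⌉₊ * (626 * (E * lg))) := by
          gcongr
          linarith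
      _ = _ := by ring
  have h3 := mul_le_mul_of_nonneg_right h2 hM
  have h4 : 0 ≤ (⌈c + 4⌉₊ : ℝ) * (E ^ 2 * lg ^ 5) := by positivity
  have h5 : 0 ≤ M * E * lg ^ 2 := by positivity
  nlinarith

end ISQuery

theorem mainTheorem2 :
    ∀ c : ℝ, 0 < c →
      ∃ C : ℝ, 0 < C ∧
        ∃ A : (n : ℕ) → (ε : ℝ) → ISQuery.RandomizedAlgorithm n,
          ∀ (n : ℕ) (ε : ℝ), 1 ≤ n → 0 < ε →
            ∀ G : SimpleGraph (Fin n),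
              ENNReal.ofReal (1 - 1 / (n : ℝ) ^ c) ≤
                (A n ε).toOuterMeasure
                  {T : ISQuery.DecisionTree n |
                    ISQuery.IsApprox ε (ISQuery.numEdges G) (T.estimate G) ∧
                    (T.queryCount G : ℝ) ≤
                      C * ISQuery.queryBound n ε (ISQuery.numEdges G)} := by
  classical
  intro c _
  refine ⟨25 * 577 ^ 2 + 10016 * ⌈c + 4⌉₊, by positivity, ISQuery.algorithm c, ?_⟩
  intro n ε hn hε G
  rw [ISQuery.algorithm]
  split_ifs with h
  · obtain ⟨hn2, hε1⟩ := h
    have : NeZero n := ⟨by omega⟩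
    have hn0 : (0 : ℝ) < n := by exact_mod_cast hn
    -- Accuracy `δ = ε / 3` explains the constant `576 = 64 * 9`.
    have hW : 64 ≤ (ε / 3) ^ 2 * (ISQuery.sampleParam ε : ℝ) := by
      have : 576 / ε ^ 2 ≤ (ISQuery.sampleParam ε : ℝ) := Nat.le_ceil _
      rw [div_le_iff₀ (by positivity)] at this
      linarith
    have hbad := ISQuery.edgeEstimator_bad_le G (by positivity : 0 < ε / 3) (by linarith) hW
      (by omega) (Nat.le_pow_clog one_lt_two n) (ISQuery.numTrials c n)
    have htr := ISQuery.clog_add_one_mul_rpow_le (c := c) hn2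
    have hpow : (0 : ℝ) < (n : ℝ) ^ c := Real.rpow_pos_of_pos hn0 c
    refine ISQuery.le_toOuterMeasure_map_uniformOfFintype _ _ (fun q =>
      ¬ISQuery.GoodOutcome G (ε / 3) (Nat.clog 2 n) (ISQuery.sampleParam ε)
        (ISQuery.numTrials c n)
        (ISQuery.edgeEstimator (ε / 3) (Nat.clog 2 n) (ISQuery.sampleParam ε) q)) ?_ _ ?_
    · intro q hgood
      rw [Set.mem_ofPred_eq, ISQuery.QueryTree.estimate_toDecisionTree,
        ISQuery.QueryTree.queryCount_toDecisionTree]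
      obtain ⟨h1, h2⟩ := not_not.1 hgood
      rw [mul_div_cancel₀ ε (by norm_num : (3 : ℝ) ≠ 0)] at h1
      exact ⟨h1, h2.trans (ISQuery.cost_bound_le hn2 hε hε1 _)⟩
    · have hbadR := (Nat.cast_le (α := ℝ)).2 hbad
      rw [Nat.cast_mul, Nat.cast_mul, Nat.cast_pow, Nat.cast_ofNat] at hbadR
      have h2t : (0 : ℝ) < 2 ^ ISQuery.numTrials c n := by positivity
      rw [one_div, inv_mul_eq_div, le_div_iff₀ hpow]
      refine le_of_mul_le_mul_right ?_ h2t
      refine le_trans (le_of_eq (mul_right_comm _ _ _)) ?_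
      refine (mul_le_mul_of_nonneg_right hbadR hpow.le).trans ?_
      rw [mul_right_comm, mul_comm]
      exact mul_le_mul_of_nonneg_left htr (Nat.cast_nonneg _)
  · have hmem : ISQuery.DecisionTree.output 0 ∈ {T : ISQuery.DecisionTree n |
        ISQuery.IsApprox ε (ISQuery.numEdges G) (T.estimate G) ∧
        (T.queryCount G : ℝ) ≤ (25 * 577 ^ 2 + 10016 * ⌈c + 4⌉₊)
          * ISQuery.queryBound n ε (ISQuery.numEdges G)} := by
      have hm : (0 : ℝ) ≤ ISQuery.numEdges G := Nat.cast_nonneg _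
      refine ⟨⟨?_, ?_⟩, ?_⟩
      · rw [ISQuery.DecisionTree.estimate]
        -- No queries are made here: either `n = 1`, so there are no edges, or `1 ≤ ε`, so the lower
        -- bound is nonpositive.
        by_cases hε1 : ε < 1
        · have hn1 : n = 1 := by
            by_contra hne
            exact h ⟨by omega, hε1⟩
          subst hn1
          have : ISQuery.numEdges G = 0 := by
            rw [ISQuery.numEdges, Subsingleton.elim G ⊥]
            simp
          rw [this]
          simp
        · exact mul_nonpos_of_nonpos_of_nonneg (by linarith) hm
      · rw [ISQuery.DecisionTree.estimate]
        positivity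
      · rw [ISQuery.DecisionTree.queryCount, Nat.cast_zero]
        have hlg : 0 ≤ Real.logb 2 n :=
          Real.logb_nonneg (by norm_num) (by exact_mod_cast hn)
        rw [ISQuery.queryBound]
        positivity
    rw [PMF.toOuterMeasure_pure_apply, if_pos hmem, ← ENNReal.ofReal_one]
    refine ENNReal.ofReal_le_ofReal (sub_le_self _ ?_)
    positivity
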